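/- Let $\mathbb S^n\subset\mathbb R^{n+1}$ be the unit sphere with its round metric and Levi-Civita connection $\nabla$, and let $p,q\in\mathbb R$ ($q<0$ is allowed). Write $\nabla^*\nabla\sigma=-\operatorname{trace}\nabla^2\sigma$, $\Delta f=-\operatorname{div}\nabla f$ and $X(\sigma)=\nabla(|\sigma|^2/2)$. A smooth vector field $\sigma$ on $\mathbb S^n$ is called $(p,q)$-harmonic if it satisfies $$(1+|\sigma|^2)\nabla^*\nabla\sigma+2p\,\nabla_{X(\sigma)}\sigma=\Big[p|\nabla\sigma|^2-pq|X(\sigma)|^2-q(1+|\sigma|^2)\Delta\big(\tfrac12|\sigma|^2\big)\Big]\sigma ,$$ the Euler–Lagrange equation of the vertical energy for the generalised Cheeger–Gromoll metric $h_{p,q}$ under variations through sections. For a symmetric linear map $B$ of $\mathbb R^{n+1}$ put $\lambda(x)=Bx\cdot x$ on $\mathbb S^n$; the spherical gradient $\sigma=\tfrac12\nabla\lambda$ is called a quadratic gradient vector field. For $q\ne0$ put $$\mu^2=\mu^2(n,q)=\frac{9-n^2}{2q}-2(n+3),$$ and call $q$ admissible (for $n$) if $q\neq 0$, $$8(n+1)q^2+2(3n^2-2n-17)q+(n-3)(n^2-9)=0\qquad\text{and}\qquad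 \mu^2>0 .$$ **Theorem.** Let $n\in\mathbb N$. (1) Let $p,q\in\mathbb R$. There is a nonzero $(p,q)$-harmonic quadratic gradient vector field on $\mathbb S^n$ if and only if $n$ is odd, $n\ge5$, $p=\frac{n+3}2$ and $q$ is admissible. (2) More precisely, let $p,q\in\mathbb R$ and let $\sigma=\tfrac12\nabla(Bx\cdot x)$ be a nonzero quadratic gradient vector field on $\mathbb S^n$. Then $\sigma$ is $(p,q)$-harmonic if and only if $n$ is odd, $n\ge5$, $p=\frac{n+3}2$, $q$ is admissible, and $B$ has exactly two distinct eigenvalues $\alpha\ne\beta$, each of multiplicity $\frac{n+1}2$, with $|\alpha-\beta|=\mu$, where $\mu=\sqrt{\mu^2}$. (3) If $n$ is odd and $n\ge5$, there is exactly one admissible $q$, and it is negative. -/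

import Mathlib

open scoped Manifold ContDiff

noncomputable section

namespace SphereField

/-- The ambient Euclidean space `ℝⁿ⁺¹`. -/
abbrev Amb (n : ℕ) : Type := EuclideanSpace ℝ (Fin (n + 1))

/-- The unit sphere `𝕊ⁿ ⊂ ℝⁿ⁺¹`, with its round metric. -/
abbrev Sph (n : ℕ) : Type := Metric.sphere (0 : Amb n) 1

instance finrankAmb (n : ℕ) : Fact (Module.finrank ℝ (Amb n) = n + 1) :=
  ⟨by simp⟩

/-- The tangent space `T_x 𝕊ⁿ = x^⊥`, as a subspace of `ℝⁿ⁺¹`. -/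
def tangentSpace {n : ℕ} (x : Sph n) : Submodule ℝ (Amb n) :=
  (Submodule.span ℝ {(x : Amb n)})ᗮ

/-- The orthogonal projection of `ℝⁿ⁺¹` onto `T_x 𝕊ⁿ`. -/
def tangentProj {n : ℕ} (x : Sph n) : Amb n →L[ℝ] Amb n :=
  (tangentSpace x).starProjection

/-- The extension of a map `f` on the sphere to `ℝⁿ⁺¹ ∖ {0}` that is constant on rays,
`y ↦ f (y / ‖y‖)` (and `0` at the origin). Its derivative at a point `x` of the sphere in a
tangent direction `X` is the derivative of `f` along `X`, and its derivative in the radial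
direction is zero. -/
def radialExt {n : ℕ} {F : Type*} [Zero F] (f : Sph n → F) (y : Amb n) : F :=
  open Classical in
  if h : y = 0 then 0
  else f ⟨‖y‖⁻¹ • y, by
    rw [mem_sphere_zero_iff_norm, norm_smul, norm_inv, norm_norm,
      inv_mul_cancel₀ (norm_ne_zero_iff.mpr h)]⟩

/-- `sphDeriv f x X` is the derivative at `x` along `X ∈ T_x 𝕊ⁿ` of a map `f` from the sphere
to a normed space. -/
def sphDeriv {n : ℕ} {F : Type*} [NormedAddCommGroup F] [NormedSpace ℝ F]
    (f : Sph n → F) (x : Sph n) : Amb n →L[ℝ] F :=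
  fderiv ℝ (radialExt f) (x : Amb n)

/-- A smooth vector field on `𝕊ⁿ`, seen as a map to `ℝⁿ⁺¹`. -/
structure IsSmoothVectorField {n : ℕ} (σ : Sph n → Amb n) : Prop where
  tangent : ∀ x : Sph n, σ x ∈ tangentSpace x
  smooth : ContMDiff (𝓡 n) 𝓘(ℝ, Amb n) ∞ σ

/-- The Riemannian gradient `∇f` on `𝕊ⁿ` of a function: the tangent vector representing the
differential of `f`. -/
def sphGrad {n : ℕ} (f : Sph n → ℝ) (x : Sph n) : Amb n :=
  tangentProj x (gradient (radialExt f) (x : Amb n))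

/-- The covariant derivative `X ↦ ∇_X σ` at `x` for the Levi-Civita connection of `𝕊ⁿ`, i.e. the
tangential part of the derivative of `σ` along `X`. It is an endomorphism of `T_x 𝕊ⁿ`, extended
by zero on the normal line. -/
def covDeriv {n : ℕ} (σ : Sph n → Amb n) (x : Sph n) : Amb n →L[ℝ] Amb n :=
  (tangentProj x).comp ((sphDeriv σ x).comp (tangentProj x))

/-- The second covariant derivative
`∇²_{X,Y} σ = (∇_X (∇σ))(Y) = ∇_X ∇_Y σ - ∇_{∇_X Y} σ` for `X, Y ∈ T_x 𝕊ⁿ`. -/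
def covDeriv₂ {n : ℕ} (σ : Sph n → Amb n) (x : Sph n) (X Y : Amb n) : Amb n :=
  tangentProj x (sphDeriv (covDeriv σ) x X Y)

/-- An orthonormal basis of `T_x 𝕊ⁿ`, used for traces. -/
def tangentBasis {n : ℕ} (x : Sph n) :
    OrthonormalBasis (Fin (Module.finrank ℝ (tangentSpace x))) ℝ (tangentSpace x) :=
  stdOrthonormalBasis ℝ (tangentSpace x)

/-- The rough Laplacian `∇*∇σ = - trace ∇²σ`. -/
def roughLaplacian {n : ℕ} (σ : Sph n → Amb n) (x : Sph n) : Amb n :=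
  -∑ i, covDeriv₂ σ x (tangentBasis x i : Amb n) (tangentBasis x i : Amb n)

/-- `|∇σ|² = ∑ᵢ |∇_{eᵢ} σ|²`. -/
def normSqCovDeriv {n : ℕ} (σ : Sph n → Amb n) (x : Sph n) : ℝ :=
  ∑ i, ‖covDeriv σ x (tangentBasis x i : Amb n)‖ ^ 2

/-- The Laplacian of a function on `𝕊ⁿ`, with the sign for which it is a nonnegative operator:
`Δf = - div ∇f`. -/
def sphLaplacian {n : ℕ} (f : Sph n → ℝ) (x : Sph n) : ℝ :=
  -∑ i, inner ℝ (covDeriv (sphGrad f) x (tangentBasis x i : Amb n))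
    (tangentBasis x i : Amb n)

/-- The function `|σ|² / 2`. -/
def halfNormSq {n : ℕ} (σ : Sph n → Amb n) (x : Sph n) : ℝ := ‖σ x‖ ^ 2 / 2

/-- `X(σ) = ∇(|σ|² / 2)`. -/
def gradHalfNormSq {n : ℕ} (σ : Sph n → Amb n) : Sph n → Amb n := sphGrad (halfNormSq σ)

/-- A smooth vector field `σ` on `𝕊ⁿ` is `(p,q)`-harmonic if it solves
`(1+|σ|²) ∇*∇σ + 2p ∇_{X(σ)} σ = [p|∇σ|² - pq|X(σ)|² - q(1+|σ|²) Δ(|σ|²/2)] σ`,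
the Euler-Lagrange equation, for variations through sections, of the vertical energy for the
generalised Cheeger-Gromoll metric `h_{p,q}`. -/
structure IsPQHarmonic {n : ℕ} (p q : ℝ) (σ : Sph n → Amb n) : Prop where
  isSmoothVectorField : IsSmoothVectorField σ
  equation : ∀ x : Sph n,
    (1 + ‖σ x‖ ^ 2) • roughLaplacian σ x + (2 * p) • covDeriv σ x (gradHalfNormSq σ x) =
      (p * normSqCovDeriv σ x - p * q * ‖gradHalfNormSq σ x‖ ^ 2
        - q * (1 + ‖σ x‖ ^ 2) * sphLaplacian (halfNormSq σ) x) • σ x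

/-- The quadratic gradient field `σ = ½ ∇λ`, where `λ(x) = Bx · x` on `𝕊ⁿ`. -/
def quadGradField {n : ℕ} (B : Amb n →ₗ[ℝ] Amb n) (x : Sph n) : Amb n :=
  (1 / 2 : ℝ) • sphGrad (fun y : Sph n => inner ℝ (B (y : Amb n)) (y : Amb n)) x

/-- The number `μ² = (9 - n²) / (2q) - 2(n + 3)`. -/
def muSq (n : ℕ) (q : ℝ) : ℝ := (9 - (n : ℝ) ^ 2) / (2 * q) - 2 * ((n : ℝ) + 3)

/-- `q` is a nonzero root of `8(n+1)q² + 2(3n² - 2n - 17)q + (n-3)(n² - 9)` with `μ² > 0`. -/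
def AdmissibleQ (n : ℕ) (q : ℝ) : Prop :=
  q ≠ 0 ∧
  8 * ((n : ℝ) + 1) * q ^ 2 + 2 * (3 * (n : ℝ) ^ 2 - 2 * n - 17) * q
    + ((n : ℝ) - 3) * ((n : ℝ) ^ 2 - 9) = 0 ∧ 0 < muSq n q

/-- `B` has exactly two distinct eigenvalues, both of multiplicity `(n+1)/2`, and they differ by
`μ`. -/
def HasTwoEigenvalues {n : ℕ} (B : Amb n →ₗ[ℝ] Amb n) (μ : ℝ) : Prop :=
  ∃ α β : ℝ, α ≠ β ∧
    (∀ c : ℝ, Module.End.HasEigenvalue B c ↔ c = α ∨ c = β) ∧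
    2 * Module.finrank ℝ (Module.End.eigenspace B α) = n + 1 ∧
    2 * Module.finrank ℝ (Module.End.eigenspace B β) = n + 1 ∧
    |α - β| = μ

end SphereField

end

noncomputable section

namespace SphereField

/-! ### Calculus on the sphere through ambient extensions -/

section

variable {n : ℕ}

/-! Write `m = Bx · x`. The field is `σ = Bx - m x`, it satisfies `∇*∇σ = (n+3) σ`, and every scalar
in the equation is a polynomial in `m`, `|Bx|²`, `tr B`, `tr B²`, apart from `|X(σ)|²`. If `B²x =
(α+β) Bx - αβ x`, then `X(σ)` and `∇_σ σ` both equal `(α+β-2m) σ`, so the equation at `x` becomes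
one scalar condition, `eulerFactor = 0`, wherever `σ x ≠ 0` (`equation_iff_eulerFactor`).

Necessity. Since `σ ≠ 0`, `B` has two distinct eigenvalues `α`, `β`, and on a great circle through
corresponding eigenvectors `m` takes every value strictly between them. The scalar condition there
forces `p ≠ 0`. Then the equation makes `∇_{X(σ)} σ` a multiple of `σ`, which expresses `B³x`
through `B²x`, `Bx`, `x` with leading coefficient `3m`; a third eigenvalue would fix `m` on an open
set of points of a 2-sphere, so there is none (`IsPQHarmonic.eigenvalue_eq_or_eq`). Exchanging the
roles of `α` and `β` along the circle forces equal multiplicities, so `n` is odd. The factor is then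
a quadratic polynomial in `|σ|²`, and its three vanishing coefficients give `p`, `(α-β)² = μ²` and
the equation for `q`.

Sufficiency. With two eigenvalues the quadratic relation for `B` holds at every point, and the same
three coefficients vanish. Uniqueness of `q` is a sign count for a quadratic polynomial. -/

lemma norm_coe_sph (x : Sph n) : ‖(x : Amb n)‖ = 1 := by simp

lemma inner_self_sph (x : Sph n) : inner ℝ (x : Amb n) x = 1 := by
  rw [real_inner_self_eq_norm_sq, norm_coe_sph, one_pow]

lemma tangentProj_apply (x : Sph n) (v : Amb n) :
    tangentProj x v = v - inner ℝ (x : Amb n) v • (x : Amb n) := by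
  change ((Submodule.span ℝ {(x : Amb n)})ᗮ).starProjection v = _
  rw [Submodule.starProjection_orthogonal_val,
    Submodule.starProjection_unit_singleton ℝ (norm_coe_sph x)]

lemma mem_tangentSpace {x : Sph n} {v : Amb n} :
    v ∈ tangentSpace x ↔ inner ℝ (x : Amb n) v = 0 :=
  Submodule.mem_orthogonal_singleton_iff_inner_right

lemma inner_tangentProj (x : Sph n) (v : Amb n) : inner ℝ (x : Amb n) (tangentProj x v) = 0 :=
  mem_tangentSpace.1 (Submodule.starProjection_apply_mem _ _)

lemma tangentProj_of_inner_eq_zero {x : Sph n} {v : Amb n} (h : inner ℝ (x : Amb n) v = 0) :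
    tangentProj x v = v := by simp [tangentProj_apply, h]

/-- `radialExt` is composition with this retraction, so all derivatives on the sphere reduce to
ambient derivatives precomposed with the tangent projection. -/
lemma hasFDerivAt_normalize (x : Sph n) :
    HasFDerivAt (fun y : Amb n => ‖y‖⁻¹ • y) (tangentProj x) (x : Amb n) := by
  have hx : ‖(x : Amb n)‖ = 1 := norm_coe_sph x
  have h1 : HasFDerivAt (fun y : Amb n => ‖y‖ ^ 2) (2 • innerSL ℝ (x : Amb n)) (x : Amb n) :=
    (hasStrictFDerivAt_norm_sq (x : Amb n)).hasFDerivAt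
  have h2 := (hasDerivAt_inv (x := √(‖(x : Amb n)‖ ^ 2)) (by simp)).comp_hasFDerivAt
    (x : Amb n) (h1.sqrt (by simp))
  have h3 : HasFDerivAt (fun y : Amb n => ‖y‖⁻¹) (-innerSL ℝ (x : Amb n)) (x : Amb n) := by
    simp only [Function.comp_def, Real.sqrt_sq (norm_nonneg _)] at h2
    refine h2.congr_fderiv ?_
    ext v
    simp
  refine (h3.smul (hasFDerivAt_id (x : Amb n))).congr_fderiv ?_
  ext1 v
  simp [tangentProj_apply, sub_eq_add_neg]

/-- The derivative along the sphere of the restriction of an ambient map. -/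
lemma sphDeriv_eq {F : Type*} [NormedAddCommGroup F] [NormedSpace ℝ F] {f : Sph n → F}
    {g : Amb n → F} {g' : Amb n →L[ℝ] F} {x : Sph n} (hfg : ∀ y : Sph n, f y = g y)
    (hg : HasFDerivAt g g' (x : Amb n)) : sphDeriv f x = g'.comp (tangentProj x) := by
  refine HasFDerivAt.fderiv ?_
  have hx : ‖(x : Amb n)‖ = 1 := norm_coe_sph x
  have hx0 : (x : Amb n) ≠ 0 := fun h => by simp [h] at hx
  have hg1 : HasFDerivAt g g' (‖(x : Amb n)‖⁻¹ • (x : Amb n)) := by simpa [hx] using hg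
  refine (HasFDerivAt.comp (f := fun y : Amb n => ‖y‖⁻¹ • y) (x : Amb n) hg1
    (hasFDerivAt_normalize x)).congr_of_eventuallyEq ?_
  filter_upwards [isOpen_ne.mem_nhds hx0] with y hy
  have hy' : y ≠ 0 := hy
  simp [radialExt, hy', hfg]

lemma sphGrad_eq {f : Sph n → ℝ} {g : Amb n → ℝ} {g' : Amb n →L[ℝ] ℝ} {w : Amb n} {x : Sph n}
    (hfg : ∀ y : Sph n, f y = g y) (hg : HasFDerivAt g g' (x : Amb n))
    (hw : ∀ v, g' v = inner ℝ w v) : sphGrad f x = tangentProj x w := by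
  have h1 : fderiv ℝ (radialExt f) (x : Amb n) = g'.comp (tangentProj x) := sphDeriv_eq hfg hg
  have h2 : gradient (radialExt f) (x : Amb n) = tangentProj x w := by
    rw [gradient, h1, LinearIsometryEquiv.symm_apply_eq]
    ext v
    simp only [ContinuousLinearMap.comp_apply, hw, InnerProductSpace.toDual_apply_apply]
    exact (Submodule.inner_starProjection_left_eq_right _ w v).symm
  rw [sphGrad, h2]
  exact tangentProj_of_inner_eq_zero (inner_tangentProj x w)

lemma inner_tangentBasis (x : Sph n) (i) : inner ℝ (x : Amb n) (tangentBasis x i : Amb n) = 0 :=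
  mem_tangentSpace.1 (tangentBasis x i).2

lemma norm_tangentBasis (x : Sph n) (i) : ‖(tangentBasis x i : Amb n)‖ = 1 :=
  (tangentBasis x).orthonormal.1 i

lemma tangentProj_tangentBasis (x : Sph n) (i) :
    tangentProj x (tangentBasis x i : Amb n) = tangentBasis x i :=
  tangentProj_of_inner_eq_zero (inner_tangentBasis x i)

lemma sum_inner_smul_tangentBasis (x : Sph n) (u : Amb n) :
    ∑ i, inner ℝ u (tangentBasis x i : Amb n) • (tangentBasis x i : Amb n) = tangentProj x u := by
  have h := congrArg (Subtype.val) ((tangentBasis x).sum_repr'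
    ((tangentSpace x).orthogonalProjectionOnto u))
  rw [Submodule.coe_sum] at h
  refine Eq.trans (Finset.sum_congr rfl fun i _ => ?_) h
  rw [Submodule.coe_smul, Submodule.coe_inner]
  congr 1
  rw [real_inner_comm]
  exact (congrArg (fun w => inner ℝ w u) (tangentProj_tangentBasis x i)).symm.trans
    (Submodule.inner_starProjection_left_eq_right _ _ _)

lemma sum_inner_sq_tangentBasis (x : Sph n) (u : Amb n) :
    ∑ i, inner ℝ u (tangentBasis x i : Amb n) ^ 2 =
      inner ℝ u u - inner ℝ (x : Amb n) u ^ 2 := by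
  have h := congrArg (inner ℝ u) (sum_inner_smul_tangentBasis x u)
  simp only [inner_sum, inner_smul_right, tangentProj_apply, inner_sub_right] at h
  rw [real_inner_comm] at h ⊢
  simp only [pow_two, real_inner_comm u] at h ⊢
  simpa using h

/-- The tangent basis together with `x` is orthonormal in the ambient space, so the tangential trace
is the full trace minus the normal entry. -/
lemma sum_inner_map_tangentBasis (x : Sph n) (A : Amb n →ₗ[ℝ] Amb n) :
    ∑ i, inner ℝ (A (tangentBasis x i)) (tangentBasis x i : Amb n) =
      LinearMap.trace ℝ _ A - inner ℝ (A x) (x : Amb n) := by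
  let b := stdOrthonormalBasis ℝ (Amb n)
  have h1 : ∀ v w : Amb n, inner ℝ (A v) w = ∑ j, inner ℝ v (b j) * inner ℝ (A (b j)) w := by
    intro v w
    conv_lhs => rw [← b.sum_repr' v]
    simp [sum_inner, inner_smul_left, real_inner_comm]
  rw [LinearMap.trace_eq_sum_inner A b, h1 x x, ← Finset.sum_sub_distrib]
  simp_rw [h1 (tangentBasis x _ : Amb n)]
  rw [Finset.sum_comm]
  refine Finset.sum_congr rfl fun j _ => ?_
  have h := congrArg (inner ℝ (A (b j))) (sum_inner_smul_tangentBasis x (b j))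
  simp only [inner_sum, inner_smul_right, tangentProj_apply, inner_sub_right] at h
  rw [real_inner_comm, ← h]
  simp [real_inner_comm]

lemma sum_one_tangentBasis (x : Sph n) :
    ∑ _i : Fin (Module.finrank ℝ (tangentSpace x)), (1 : ℝ) = n := by
  have h := sum_inner_map_tangentBasis x LinearMap.id
  simpa [norm_tangentBasis] using h

end

/-! ### The terms of the equation for a quadratic gradient field -/

section

variable {n : ℕ} {B : Amb n →ₗ[ℝ] Amb n}

lemma hasFDerivAt_linear (B : Amb n →ₗ[ℝ] Amb n) (x : Amb n) :
    HasFDerivAt (fun y => B y) B.toContinuousLinearMap x :=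
  B.toContinuousLinearMap.hasFDerivAt

lemma hasFDerivAt_quad (hB : B.IsSymmetric) (x : Amb n) :
    HasFDerivAt (fun y => inner ℝ (B y) y) ((2 : ℝ) • innerSL ℝ (B x)) x := by
  refine ((hasFDerivAt_linear B x).inner ℝ (hasFDerivAt_id x)).congr_fderiv ?_
  ext1 v
  simp [fderivInnerCLM_apply, hB v x, real_inner_comm, two_mul]

lemma isSymmetric_comp_self (hB : B.IsSymmetric) : (B ∘ₗ B).IsSymmetric := fun u v => by
  simp [hB _ _]

lemma hasFDerivAt_quad_sq (hB : B.IsSymmetric) (x : Amb n) :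
    HasFDerivAt (fun y => inner ℝ (B (B y)) y) ((2 : ℝ) • innerSL ℝ (B (B x))) x :=
  hasFDerivAt_quad (isSymmetric_comp_self hB) x

lemma quadGradField_apply (hB : B.IsSymmetric) (x : Sph n) :
    quadGradField B x = B x - inner ℝ (B x) (x : Amb n) • (x : Amb n) := by
  rw [quadGradField, sphGrad_eq (w := (2 : ℝ) • B x) (fun _ => rfl) (hasFDerivAt_quad hB x)
    (fun v => by simp [inner_smul_left])]
  rw [map_smul, smul_smul, tangentProj_apply, real_inner_comm]
  norm_num

lemma isSmoothVectorField_quadGradField (hB : B.IsSymmetric) :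
    IsSmoothVectorField (quadGradField B) where
  tangent x := by
    rw [quadGradField_apply hB, mem_tangentSpace, inner_sub_right, inner_smul_right,
      inner_self_sph, real_inner_comm]
    ring
  smooth := by
    have h1 : ContDiff ℝ ∞ (fun y : Amb n => B.toContinuousLinearMap y -
        inner ℝ (B.toContinuousLinearMap y) y • y) :=
      B.toContinuousLinearMap.contDiff.sub
        ((B.toContinuousLinearMap.contDiff.inner ℝ contDiff_id).smul contDiff_id)
    have h2 := h1.contMDiff.comp (contMDiff_coe_sphere (E := Amb n) (n := n) (m := ∞))
    refine h2.congr fun x => ?_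
    rw [quadGradField_apply hB]
    rfl

lemma norm_sq_quadGradField (hB : B.IsSymmetric) (x : Sph n) :
    ‖quadGradField B x‖ ^ 2 =
      inner ℝ (B (B x)) (x : Amb n) - inner ℝ (B x) (x : Amb n) ^ 2 := by
  rw [quadGradField_apply hB, ← real_inner_self_eq_norm_sq, hB (B x) x]
  simp only [inner_sub_left, inner_sub_right, inner_smul_left, inner_smul_right, inner_self_sph,
    real_inner_comm (B x) (x : Amb n), conj_trivial]
  ring

lemma hasFDerivAt_quadGrad (hB : B.IsSymmetric) (x : Amb n) :
    HasFDerivAt (fun y => B y - inner ℝ (B y) y • y)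
      (B.toContinuousLinearMap - (inner ℝ (B x) x • ContinuousLinearMap.id ℝ (Amb n) +
        ((2 : ℝ) • innerSL ℝ (B x)).smulRight x)) x :=
  (hasFDerivAt_linear B x).sub ((hasFDerivAt_quad hB x).smul (hasFDerivAt_id x))

lemma tangentProj_self (x : Sph n) : tangentProj x (x : Amb n) = 0 := by
  rw [tangentProj_apply, inner_self_sph, one_smul, sub_self]

lemma covDeriv_quadGradField (hB : B.IsSymmetric) (x : Sph n) (Y : Amb n) :
    covDeriv (quadGradField B) x Y =
      tangentProj x (B (tangentProj x Y)) - inner ℝ (B x) (x : Amb n) • tangentProj x Y := by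
  have hP : ∀ v, tangentProj x (tangentProj x v) = tangentProj x v := fun v =>
    tangentProj_of_inner_eq_zero (inner_tangentProj x v)
  rw [covDeriv, sphDeriv_eq (quadGradField_apply hB) (hasFDerivAt_quadGrad hB x)]
  simp [hP, tangentProj_self]

lemma covDeriv_quadGradField_of_tangent (hB : B.IsSymmetric) {x : Sph n} {Y : Amb n}
    (hY : inner ℝ (x : Amb n) Y = 0) :
    covDeriv (quadGradField B) x Y =
      B Y - inner ℝ (B x) Y • (x : Amb n) - inner ℝ (B x) (x : Amb n) • Y := by
  rw [covDeriv_quadGradField hB, tangentProj_of_inner_eq_zero hY, tangentProj_apply,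
    ← hB]

/-- An ambient extension of the covariant derivative of a quadratic gradient field. -/
def covDerivExt (B : Amb n →ₗ[ℝ] Amb n) (y : Amb n) : Amb n →L[ℝ] Amb n :=
  let Q : Amb n →L[ℝ] Amb n := ContinuousLinearMap.id ℝ (Amb n) - (innerSL ℝ y).smulRight y
  Q.comp (B.toContinuousLinearMap.comp Q) -
    inner ℝ (B.toContinuousLinearMap y) y • Q

/-- In `covDerivExt` the projection is replaced by `v - (y · v) y`, which agrees with `tangentProj`
on the sphere but is polynomial in `y`. -/
lemma differentiable_covDerivExt (B : Amb n →ₗ[ℝ] Amb n) : Differentiable ℝ (covDerivExt B) := by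
  have h1 : Differentiable ℝ (fun y : Amb n => ContinuousLinearMap.id ℝ (Amb n) -
      (innerSL ℝ y).smulRight y) := by
    have h : Differentiable ℝ (fun y : Amb n =>
        ContinuousLinearMap.smulRightL ℝ (Amb n) (Amb n) (innerSL ℝ y) y) :=
      Differentiable.clm_apply
        ((ContinuousLinearMap.differentiable _).comp (innerSL ℝ).differentiable) differentiable_id
    exact (differentiable_const _).sub h
  exact (h1.clm_comp ((differentiable_const _).clm_comp h1)).sub
    ((B.toContinuousLinearMap.differentiable.inner ℝ differentiable_id).smul h1)

lemma covDerivExt_apply (hB : B.IsSymmetric) (y Y : Amb n) :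
    covDerivExt B y Y = B Y - inner ℝ y Y • B y - inner ℝ (B y) Y • y
      + (2 * inner ℝ y Y * inner ℝ (B y) y) • y - inner ℝ (B y) y • Y := by
  simp only [covDerivExt, sub_apply, ContinuousLinearMap.comp_apply,
    smul_apply, ContinuousLinearMap.id_apply,
    ContinuousLinearMap.smulRight_apply, innerSL_apply_apply, LinearMap.coe_toContinuousLinearMap',
    map_sub, map_smul, ← hB y]
  module

lemma covDeriv_eq_covDerivExt (hB : B.IsSymmetric) (x : Sph n) :
    covDeriv (quadGradField B) x = covDerivExt B x := by
  ext1 Y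
  rw [covDeriv_quadGradField hB, covDerivExt_apply hB]
  simp only [tangentProj_apply, map_sub, map_smul, ← hB _ _]
  module

lemma hasFDerivAt_covDerivExt_apply (hB : B.IsSymmetric) (x Y : Amb n) :
    HasFDerivAt (fun y => covDerivExt B y Y)
      (-(inner ℝ x Y • B.toContinuousLinearMap + (innerSL ℝ Y).smulRight (B x))
        - (inner ℝ (B x) Y • ContinuousLinearMap.id ℝ (Amb n) +
          (innerSL ℝ (B Y)).smulRight x)
        + ((2 * inner ℝ x Y * inner ℝ (B x) x) • ContinuousLinearMap.id ℝ (Amb n)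
          + ((2 * inner ℝ x Y) • ((2 : ℝ) • innerSL ℝ (B x)) +
              inner ℝ (B x) x • ((2 : ℝ) • innerSL ℝ Y)).smulRight x)
        - ((2 : ℝ) • innerSL ℝ (B x)).smulRight Y) x := by
  have h1 : HasFDerivAt (fun y : Amb n => inner ℝ y Y) (innerSL ℝ Y) x := by
    simp only [real_inner_comm Y]
    exact (innerSL ℝ Y).hasFDerivAt
  have h2 : HasFDerivAt (fun y : Amb n => inner ℝ (B y) Y) (innerSL ℝ (B Y)) x := by
    simp only [hB _ Y, real_inner_comm (B Y)]
    exact (innerSL ℝ (B Y)).hasFDerivAt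
  have h3 := hasFDerivAt_quad hB x
  simp only [covDerivExt_apply hB]
  have h := ((((h1.smul (hasFDerivAt_linear B x)).const_sub (B Y)).sub
    (h2.smul (hasFDerivAt_id x))).add
    (((h1.const_mul 2).mul h3).smul (hasFDerivAt_id x))).sub (h3.smul_const Y)
  exact h

lemma covDeriv₂_quadGradField (hB : B.IsSymmetric) {x : Sph n} {X Y : Amb n}
    (hX : inner ℝ (x : Amb n) X = 0) (hY : inner ℝ (x : Amb n) Y = 0) :
    covDeriv₂ (quadGradField B) x X Y =
      -(inner ℝ Y X • quadGradField B x) - inner ℝ (B x) Y • X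
        - (2 * inner ℝ (B x) X) • Y := by
  have hd := (differentiable_covDerivExt B (x : Amb n)).hasFDerivAt
  -- The derivative of the operator-valued map is known only to exist; uniqueness of derivatives
  -- identifies its value on a fixed `Y` with the explicit formula.
  have h1 := (hasFDerivAt_covDerivExt_apply hB (x : Amb n) Y).unique
    (hd.clm_apply (hasFDerivAt_const Y (x : Amb n)))
  have h2 := DFunLike.congr_fun h1 X
  rw [covDeriv₂, sphDeriv_eq (covDeriv_eq_covDerivExt hB) hd, ContinuousLinearMap.comp_apply,
    tangentProj_of_inner_eq_zero hX]
  simp only [add_apply, ContinuousLinearMap.comp_apply,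
    ContinuousLinearMap.flip_apply, zero_apply, map_zero, zero_add] at h2
  rw [← h2, quadGradField_apply hB]
  simp only [hY, sub_apply, add_apply,
    neg_apply,
    smul_apply, ContinuousLinearMap.smulRight_apply, innerSL_apply_apply,
    ContinuousLinearMap.id_apply, map_sub, map_add, map_neg, map_smul, tangentProj_self,
    tangentProj_of_inner_eq_zero hX, tangentProj_of_inner_eq_zero hY, zero_smul, mul_zero,
    zero_mul, smul_zero, smul_eq_mul]
  rw [tangentProj_apply x (B x), real_inner_comm (B x)]
  module

/-- Quadratic gradient fields are eigenfields of the rough Laplacian. -/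
lemma roughLaplacian_quadGradField (hB : B.IsSymmetric) (x : Sph n) :
    roughLaplacian (quadGradField B) x = ((n : ℝ) + 3) • quadGradField B x := by
  -- Summed over the basis, the first term gives `n σ`, and the second gives three times the
  -- tangential part of `Bx`, which is again `σ`.
  have h : ∀ i, covDeriv₂ (quadGradField B) x (tangentBasis x i : Amb n) (tangentBasis x i) =
      -((1 : ℝ) • quadGradField B x) -
        (3 : ℝ) • (inner ℝ (B x) (tangentBasis x i : Amb n) • (tangentBasis x i : Amb n)) := by
    intro i
    rw [covDeriv₂_quadGradField hB (inner_tangentBasis x i) (inner_tangentBasis x i),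
      real_inner_self_eq_norm_sq, norm_tangentBasis]
    module
  rw [roughLaplacian, Finset.sum_congr rfl fun i _ => h i, Finset.sum_sub_distrib,
    ← Finset.smul_sum, sum_inner_smul_tangentBasis, Finset.sum_neg_distrib, ← Finset.sum_smul,
    sum_one_tangentBasis, tangentProj_apply, quadGradField_apply hB, real_inner_comm]
  module

lemma normSqCovDeriv_quadGradField (hB : B.IsSymmetric) (x : Sph n) :
    normSqCovDeriv (quadGradField B) x =
      LinearMap.trace ℝ _ (B ∘ₗ B) - 2 * inner ℝ (B (B x)) (x : Amb n)
        - 2 * inner ℝ (B x) (x : Amb n) * LinearMap.trace ℝ _ B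
        + ((n : ℝ) + 3) * inner ℝ (B x) (x : Amb n) ^ 2 := by
  set m : ℝ := inner ℝ (B x) (x : Amb n) with hm
  have h : ∀ i, ‖covDeriv (quadGradField B) x (tangentBasis x i : Amb n)‖ ^ 2 =
      inner ℝ ((B ∘ₗ B) (tangentBasis x i)) (tangentBasis x i : Amb n)
        - inner ℝ (B x) (tangentBasis x i : Amb n) ^ 2
        - 2 * m * inner ℝ (B (tangentBasis x i)) (tangentBasis x i : Amb n) + m ^ 2 * 1 := by
    intro i
    have h1 := inner_tangentBasis x i
    have h2 : inner ℝ (tangentBasis x i : Amb n) (tangentBasis x i : Amb n) = (1 : ℝ) := by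
      rw [real_inner_self_eq_norm_sq, norm_tangentBasis, one_pow]
    rw [covDeriv_quadGradField_of_tangent hB h1, ← real_inner_self_eq_norm_sq, ← hm]
    set e : Amb n := (tangentBasis x i : tangentSpace x).1
    have h3 : inner ℝ (x : Amb n) (B e) = inner ℝ (B x) e := (hB _ _).symm
    have h4 : inner ℝ (B e) (x : Amb n) = inner ℝ (B x) e := by rw [real_inner_comm, h3]
    have h5 : inner ℝ e (x : Amb n) = (0 : ℝ) := by rw [real_inner_comm, h1]
    have h6 : inner ℝ e (B e) = inner ℝ (B e) e := (hB _ _).symm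
    simp only [inner_sub_left, inner_sub_right, inner_smul_left, inner_smul_right, h1, h2, h3, h4,
      h5, h6, inner_self_sph, conj_trivial, LinearMap.comp_apply, hB (B e) e]
    ring
  rw [normSqCovDeriv, Finset.sum_congr rfl fun i _ => h i, Finset.sum_add_distrib,
    Finset.sum_sub_distrib, Finset.sum_sub_distrib, ← Finset.mul_sum, ← Finset.mul_sum,
    sum_one_tangentBasis, sum_inner_map_tangentBasis, sum_inner_map_tangentBasis,
    sum_inner_sq_tangentBasis, ← hm, LinearMap.comp_apply, real_inner_comm (B x) (x : Amb n),
    ← hm, hB (B x) x]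
  ring

/-- `|σ|² = B²x · x - m²`, so half its gradient is the tangential part of `B²x - 2m Bx`. -/
lemma gradHalfNormSq_quadGradField (hB : B.IsSymmetric) (x : Sph n) :
    gradHalfNormSq (quadGradField B) x =
      B (B x) - inner ℝ (B (B x)) (x : Amb n) • (x : Amb n)
        - (2 * inner ℝ (B x) (x : Amb n)) •
          (B x - inner ℝ (B x) (x : Amb n) • (x : Amb n)) := by
  have hg : ∀ y : Sph n, halfNormSq (quadGradField B) y =
      (inner ℝ (B (B y)) (y : Amb n) - inner ℝ (B y) (y : Amb n) ^ 2) * (1 / 2) := by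
    intro y
    rw [halfNormSq, norm_sq_quadGradField hB]
    ring
  have hd := ((hasFDerivAt_quad_sq hB (x : Amb n)).sub
    ((hasFDerivAt_quad hB (x : Amb n)).pow 2)).mul_const (1 / 2)
  rw [gradHalfNormSq, sphGrad_eq (w := B (B x) - (2 * inner ℝ (B x) (x : Amb n)) • B x) hg hd]
  · rw [map_sub, map_smul, tangentProj_apply, tangentProj_apply, real_inner_comm,
      real_inner_comm (B x)]
  · intro v
    simp [inner_sub_left, inner_smul_left]
    ring

lemma sphLaplacian_halfNormSq_quadGradField (hB : B.IsSymmetric) (x : Sph n) :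
    sphLaplacian (halfNormSq (quadGradField B)) x =
      ((n : ℝ) + 5) * inner ℝ (B (B x)) (x : Amb n) - LinearMap.trace ℝ _ (B ∘ₗ B)
        - 2 * ((n : ℝ) + 3) * inner ℝ (B x) (x : Amb n) ^ 2
        + 2 * inner ℝ (B x) (x : Amb n) * LinearMap.trace ℝ _ B := by
  have hd := ((hasFDerivAt_quadGrad (isSymmetric_comp_self hB) (x : Amb n))).sub
    (((hasFDerivAt_quad hB (x : Amb n)).const_mul 2).smul (hasFDerivAt_quadGrad hB (x : Amb n)))
  set m : ℝ := inner ℝ (B x) (x : Amb n) with hm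
  set m₂ : ℝ := inner ℝ (B (B x)) (x : Amb n) with hm₂
  have h : ∀ i, inner ℝ (covDeriv (sphGrad (halfNormSq (quadGradField B))) x
      (tangentBasis x i : Amb n)) (tangentBasis x i : Amb n) =
      inner ℝ ((B ∘ₗ B) (tangentBasis x i)) (tangentBasis x i : Amb n)
        - 4 * inner ℝ (B x) (tangentBasis x i : Amb n) ^ 2
        - 2 * m * inner ℝ (B (tangentBasis x i)) (tangentBasis x i : Amb n)
        + (2 * m ^ 2 - m₂) * 1 := by
    intro i
    have h1 := inner_tangentBasis x i
    have h2 : inner ℝ (tangentBasis x i : Amb n) (tangentBasis x i : Amb n) = (1 : ℝ) := by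
      rw [real_inner_self_eq_norm_sq, norm_tangentBasis, one_pow]
    have h3 : sphDeriv (sphGrad (halfNormSq (quadGradField B))) x = _ :=
      sphDeriv_eq (g := fun y => B (B y) - inner ℝ (B (B y)) y • y
        - (2 * inner ℝ (B y) y) • (B y - inner ℝ (B y) y • y)) (gradHalfNormSq_quadGradField hB) hd
    rw [covDeriv, h3, ContinuousLinearMap.comp_apply, ContinuousLinearMap.comp_apply,
      ContinuousLinearMap.comp_apply, tangentProj_tangentBasis, tangentProj_tangentBasis,
      tangentProj_apply]
    set e : Amb n := (tangentBasis x i : tangentSpace x).1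
    simp only [sub_apply, add_apply,
      smul_apply, ContinuousLinearMap.smulRight_apply, innerSL_apply_apply,
      ContinuousLinearMap.id_apply, LinearMap.coe_toContinuousLinearMap', inner_sub_left,
      inner_add_left, inner_smul_left, h1, h2, conj_trivial, LinearMap.comp_apply, smul_eq_mul,
      ← hm₂]
    ring
  rw [sphLaplacian, Finset.sum_congr rfl fun i _ => h i, Finset.sum_add_distrib,
    Finset.sum_sub_distrib, Finset.sum_sub_distrib, ← Finset.mul_sum, ← Finset.mul_sum,
    ← Finset.mul_sum,
    sum_one_tangentBasis, sum_inner_map_tangentBasis, sum_inner_map_tangentBasis,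
    sum_inner_sq_tangentBasis, ← hm, LinearMap.comp_apply, real_inner_comm (B x) (x : Amb n),
    ← hm, ← hm₂, ← hB (B x) x, ← hm₂]
  ring

end

/-! ### Algebra of the scalar Euler-Lagrange factor -/

/-- The scalar factor of the Euler-Lagrange equation of the quadratic gradient field of `B` at a
point `x` with `B²x = (α + β) Bx - αβ x` and `Bx · x = m`, where `T` and `T₂` are the traces of
`B` and `B²` and `N` is the dimension of the sphere. -/
def eulerFactor (p q N T T₂ α β m : ℝ) : ℝ :=
  (N + 3) * (1 + (m - β) * (α - m)) + 2 * p * (α + β - 2 * m) ^ 2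
    - p * (T₂ - 2 * ((α + β) * m - α * β) - 2 * m * T + (N + 3) * m ^ 2)
    + p * q * (α + β - 2 * m) ^ 2 * ((m - β) * (α - m))
    + q * (1 + (m - β) * (α - m)) *
      ((N + 5) * ((α + β) * m - α * β) - T₂ - 2 * (N + 3) * m ^ 2 + 2 * m * T)

/-- The coefficients, in powers of `|σ|²`, of the Euler-Lagrange factor of the quadratic gradient
field of a map with two eigenvalues of equal multiplicity and squared difference `M`. -/
structure EulerCoeffsVanish (p q N M : ℝ) : Prop where
  zero : N + 3 + 2 * p * M - p * M * ((N + 1) / 2) - q * M * ((N + 1) / 2) = 0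
  one : N + 3 - 8 * p + p * (N + 3) + p * q * M + q * (2 * (N + 3) - M * ((N + 1) / 2)) = 0
  two : q * (2 * (N + 3) - 4 * p) = 0

/-- With `F = (m-β)(α-m)`, which is `|σ|²`, one has `(α+β-2m)² = (α-β)² - 4F` and `m² = (α+β)m - αβ
- F`. For balanced traces the remaining terms linear in `m` cancel, leaving a polynomial in `F`. -/
lemma eulerFactor_balanced (p q N α β m : ℝ) :
    eulerFactor p q N ((N + 1) * (α + β) / 2)
        ((α + β) * ((N + 1) * (α + β) / 2) - α * β * (N + 1)) α β m =
      (N + 3 + 2 * p * (α - β) ^ 2 - p * (α - β) ^ 2 * ((N + 1) / 2)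
          - q * (α - β) ^ 2 * ((N + 1) / 2))
        + (N + 3 - 8 * p + p * (N + 3) + p * q * (α - β) ^ 2
          + q * (2 * (N + 3) - (α - β) ^ 2 * ((N + 1) / 2))) * ((m - β) * (α - m))
        + q * (2 * (N + 3) - 4 * p) * ((m - β) * (α - m)) ^ 2 := by
  unfold eulerFactor
  ring

/-- For `p = 0` the factor is the positive number `1 + |σ|²` times a quadratic polynomial in `s`,
whose leading coefficient then forces `q = 0`, leaving `N + 3 = 0`. -/
lemma ne_zero_of_eulerFactor_eq_zero {p q N T T₂ α β : ℝ} (hN : 0 < N + 3) (hαβ : α ≠ β)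
    (h : ∀ s : ℝ, 0 < s → s < 1 → eulerFactor p q N T T₂ α β (β + s * (α - β)) = 0) :
    p ≠ 0 := by
  rintro rfl
  have hL : ∀ s : ℝ, 0 < s → s < 1 → N + 3 + q * ((N + 5) * ((α + β) * (β + s * (α - β)) - α * β)
      - T₂ - 2 * (N + 3) * (β + s * (α - β)) ^ 2 + 2 * (β + s * (α - β)) * T) = 0 := by
    intro s h0 h1
    have hF : 0 < 1 + s * (1 - s) * (α - β) ^ 2 := by
      have : 0 ≤ s * (1 - s) := mul_nonneg h0.le (by linarith)
      positivity
    refine (mul_eq_zero.1 ?_).resolve_left hF.ne'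
    rw [← h s h0 h1, eulerFactor]
    ring
  have h1 := hL (1 / 4) (by norm_num) (by norm_num)
  have h2 := hL (1 / 2) (by norm_num) (by norm_num)
  have h3 := hL (3 / 4) (by norm_num) (by norm_num)
  -- The second difference at three equally spaced points isolates the `s²` coefficient.
  have h4 : q * ((N + 3) * (α - β) ^ 2) = 0 := by
    linear_combination -4 * (h1 - 2 * h2 + h3)
  have hq : q = 0 := (mul_eq_zero.1 h4).resolve_right
    (mul_ne_zero hN.ne' (pow_ne_zero 2 (sub_ne_zero.2 hαβ)))
  rw [hq] at h1
  linarith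

/-- The reflection `s ↦ 1 - s` preserves `|σ|²` and `(α+β-2m)²`, so the odd part of the factor
carries the trace defect `2T - (N+1)(α+β)`. -/
lemma trace_eq_of_eulerFactor_eq_zero {p q N T α β : ℝ} (hp : p ≠ 0) (hαβ : α ≠ β)
    (h : ∀ s : ℝ, 0 < s → s < 1 →
      eulerFactor p q N T ((α + β) * T - α * β * (N + 1)) α β (β + s * (α - β)) = 0) :
    T = (N + 1) * (α + β) / 2 := by
  have hd : α - β ≠ 0 := sub_ne_zero.2 hαβ
  have hs : ∀ s : ℝ, 0 < s → s < 1 → (2 * T - (N + 1) * (α + β)) * ((1 - 2 * s) *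
      ((α - β) * (p + q * (1 + s * (1 - s) * (α - β) ^ 2)))) = 0 := by
    intro s h0 h1
    have e1 := h s h0 h1
    have e2 := h (1 - s) (by linarith) (by linarith)
    unfold eulerFactor at e1 e2
    linear_combination e2 - e1
  by_contra hne
  have hD : 2 * T - (N + 1) * (α + β) ≠ 0 := fun h0 => hne (by linarith)
  have h1 := (mul_eq_zero.1 (hs (1 / 4) (by norm_num) (by norm_num))).resolve_left hD
  have h2 := (mul_eq_zero.1 (hs (1 / 8) (by norm_num) (by norm_num))).resolve_left hD
  have h1' := (mul_eq_zero.1 ((mul_eq_zero.1 h1).resolve_left (by norm_num))).resolve_left hd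
  have h2' := (mul_eq_zero.1 ((mul_eq_zero.1 h2).resolve_left (by norm_num))).resolve_left hd
  -- The values of `s(1-s)` at `1/4` and `1/8` differ by `5/64`.
  have hq : q * (α - β) ^ 2 = 0 := by linear_combination (64 / 5) * (h1' - h2')
  have hq0 : q = 0 := (mul_eq_zero.1 hq).resolve_right (pow_ne_zero 2 hd)
  rw [hq0] at h1'
  exact hp (by linarith)

lemma eulerCoeffsVanish_of_eulerFactor_eq_zero {p q N α β : ℝ} (hαβ : α ≠ β)
    (h : ∀ s : ℝ, 0 < s → s < 1 → eulerFactor p q N ((N + 1) * (α + β) / 2)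
      ((α + β) * ((N + 1) * (α + β) / 2) - α * β * (N + 1)) α β (β + s * (α - β)) = 0) :
    EulerCoeffsVanish p q N ((α - β) ^ 2) := by
  have hM : (α - β) ^ 2 ≠ 0 := pow_ne_zero 2 (sub_ne_zero.2 hαβ)
  simp only [eulerFactor_balanced] at h
  -- Three distinct values of `s(1-s)`, namely `1/4`, `3/16`, `7/64`, determine a quadratic
  -- polynomial in `|σ|²`.
  have h1 := h (1 / 2) (by norm_num) (by norm_num)
  have h2 := h (1 / 4) (by norm_num) (by norm_num)
  have h3 := h (1 / 8) (by norm_num) (by norm_num)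
  have hF : ∀ s : ℝ, (β + s * (α - β) - β) * (α - (β + s * (α - β))) =
      s * (1 - s) * (α - β) ^ 2 := fun s => by ring
  rw [hF] at h1 h2 h3
  generalize (α - β) ^ 2 = M at *
  generalize hc0 : N + 3 + 2 * p * M - p * M * ((N + 1) / 2) - q * M * ((N + 1) / 2) = c₀ at *
  generalize hc1 : N + 3 - 8 * p + p * (N + 3) + p * q * M
    + q * (2 * (N + 3) - M * ((N + 1) / 2)) = c₁ at *
  generalize hc2 : q * (2 * (N + 3) - 4 * p) = c₂ at *
  have e1 : M * (c₁ + c₂ * M * (7 / 16)) = 0 := by linear_combination 16 * (h1 - h2)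
  have e2 : M * (c₁ + c₂ * M * (19 / 64)) = 0 := by linear_combination (64 / 5) * (h2 - h3)
  have e1' := (mul_eq_zero.1 e1).resolve_left hM
  have e2' := (mul_eq_zero.1 e2).resolve_left hM
  have e3 : c₂ * M = 0 := by linear_combination (64 / 9) * (e1' - e2')
  have z2 : c₂ = 0 := (mul_eq_zero.1 e3).resolve_right hM
  have z1 : c₁ = 0 := by rw [z2] at e1'; linarith
  have z0 : c₀ = 0 := by rw [z2, z1] at h1; linarith
  exact ⟨hc0.trans z0, hc1.trans z1, hc2.trans z2⟩

/-! ### Arithmetic of the admissible `q` -/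

lemma five_le_of_admissibleQ {n : ℕ} {q : ℝ} (hn : Odd n) (hq : AdmissibleQ n q) : 5 ≤ n := by
  obtain ⟨hq0, heq, hpos⟩ := hq
  by_contra hlt
  have h13 : n = 1 ∨ n = 3 := by
    obtain ⟨k, rfl⟩ := hn
    omega
  rcases h13 with rfl | rfl
  -- For `n = 1` the polynomial is `16(q-1)²` and `μ²(1, 1) = -4`; for `n = 3`, `μ² = -12`.
  · have h1 : (q - 1) ^ 2 = 0 := by push_cast at heq; linear_combination heq / 16
    have h2 : q = 1 := sub_eq_zero.1 (pow_eq_zero_iff two_ne_zero |>.1 h1)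
    rw [h2, muSq] at hpos
    norm_num at hpos
  · rw [muSq] at hpos
    norm_num at hpos

lemma EulerCoeffsVanish.admissible {n : ℕ} {p q M : ℝ} (hn : Odd n) (hM : 0 < M)
    (h : EulerCoeffsVanish p q n M) :
    p = ((n : ℝ) + 3) / 2 ∧ AdmissibleQ n q ∧ muSq n q = M := by
  have hN : (0 : ℝ) < (n : ℝ) + 3 := by positivity
  have hq : q ≠ 0 := by
    rintro rfl
    have h1 : p * (5 - n) = n + 3 := by linear_combination -h.one
    have h0 : p * M * (n - 3) = 2 * (n + 3) := by linear_combination (-2) * h.zero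
    -- If `q = 0`, multiplying the two surviving relations forces `3 < n < 5`, so `n = 4`, against
    -- oddness.
    have hprod : 0 < (p ^ 2 * M) * ((5 - (n : ℝ)) * (n - 3)) := by
      have : (p ^ 2 * M) * ((5 - (n : ℝ)) * (n - 3)) = (n + 3) * (2 * (n + 3)) := by
        rw [← h0]
        linear_combination (p * M * (n - 3)) * h1
      rw [this]
      positivity
    have hpos : 0 < (5 - (n : ℝ)) * (n - 3) := pos_of_mul_pos_right hprod (by positivity)
    obtain ⟨k, hk⟩ := hn
    have hlt : (3 : ℝ) < n := by nlinarith
    have hlt' : (n : ℝ) < 5 := by nlinarith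
    have h3 : 3 < n := by exact_mod_cast hlt
    have h5 : n < 5 := by exact_mod_cast hlt'
    omega
  have hp : p = ((n : ℝ) + 3) / 2 := by
    have := (mul_eq_zero.1 h.two).resolve_left hq
    linarith
  have h1 := h.one
  have h0 := h.zero
  rw [hp] at h1 h0
  -- For this `p` the coefficient of `q M` is `(n+3)/2 - (n+1)/2 = 1`. Substituting `q M` into the
  -- constant coefficient eliminates `M` and leaves `n + 3` times the quadratic in `q`.
  have hqM : q * M = (9 - (n : ℝ) ^ 2) / 2 - 2 * (n + 3) * q := by linear_combination h1
  have hmu : muSq n q = M := by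
    rw [muSq, sub_eq_iff_eq_add, div_eq_iff (by simpa using hq)]
    linear_combination (-2) * hqM
  refine ⟨hp, ⟨hq, ?_, hmu.symm ▸ hM⟩, hmu⟩
  refine ((mul_eq_zero (a := (n : ℝ) + 3)).1 ?_).resolve_left hN.ne'
  linear_combination 8 * q * h0 + (2 * (n ^ 2 - 9) + 4 * q * (n + 1)) * hqM

lemma eulerCoeffsVanish_of_admissibleQ {n : ℕ} {q : ℝ} (hq : AdmissibleQ n q) :
    EulerCoeffsVanish (((n : ℝ) + 3) / 2) q n (muSq n q) := by
  obtain ⟨hq0, heq, -⟩ := hq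
  have hqM : q * muSq n q = (9 - (n : ℝ) ^ 2) / 2 - 2 * (n + 3) * q := by
    rw [muSq]
    field_simp
  refine ⟨((mul_eq_zero (a := 8 * q)).1 ?_).resolve_left (by simpa using hq0), ?_, by ring⟩
  · linear_combination ((n : ℝ) + 3) * heq - (2 * (n ^ 2 - 9) + 4 * q * (n + 1)) * hqM
  · linear_combination hqM

lemma AdmissibleQ.neg {n : ℕ} {q : ℝ} (hn : 5 ≤ n) (hq : AdmissibleQ n q) : q < 0 := by
  obtain ⟨-, heq, -⟩ := hq
  have hN : (5 : ℝ) ≤ n := by exact_mod_cast hn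
  by_contra! h0
  have h1 : 0 < 3 * (n : ℝ) ^ 2 - 2 * n - 17 := by nlinarith
  have h2 : 0 < ((n : ℝ) - 3) * (n ^ 2 - 9) := mul_pos (by linarith) (by nlinarith)
  have h3 : 0 ≤ 8 * ((n : ℝ) + 1) * q ^ 2 := by positivity
  have h4 : 0 ≤ 2 * (3 * (n : ℝ) ^ 2 - 2 * n - 17) * q := by positivity
  linarith

lemma muSq_pos_iff {n : ℕ} {q : ℝ} (hq : q < 0) : 0 < muSq n q ↔ -(((n : ℝ) - 3) / 4) < q := by
  have hN : (0 : ℝ) < (n : ℝ) + 3 := by positivity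
  have h : muSq n q = ((n + 3) * 2 / -q) * (q + (n - 3) / 4) := by
    rw [muSq]
    have := hq.ne
    field_simp
    ring
  have hpos : 0 < ((n : ℝ) + 3) * 2 / -q := div_pos (by positivity) (by linarith)
  rw [h, mul_pos_iff_of_pos_left hpos]
  constructor <;> intro h <;> linarith

/-- Among negative `q`, `μ² > 0` means `q > r = -(n-3)/4`. The quadratic is negative at `r` and
positive at `0`, so it has a root between; a second root to the right of `r` would make it positive
at `r`. -/
lemma existsUnique_admissibleQ {n : ℕ} (hn : 5 ≤ n) : ∃! q : ℝ, AdmissibleQ n q := by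
  have hN : (5 : ℝ) ≤ n := by exact_mod_cast hn
  set f : ℝ → ℝ := fun q => 8 * ((n : ℝ) + 1) * q ^ 2 + 2 * (3 * (n : ℝ) ^ 2 - 2 * n - 17) * q
    + ((n : ℝ) - 3) * ((n : ℝ) ^ 2 - 9) with hf
  set r : ℝ := -(((n : ℝ) - 3) / 4) with hr
  have hr0 : r < 0 := by rw [hr]; linarith
  have hfr : f r < 0 := by
    have : f r = -2 * (n - 3) := by rw [hf, hr]; ring
    rw [this]
    linarith
  have hf0 : 0 < f 0 := by
    have : f 0 = ((n : ℝ) - 3) * (n ^ 2 - 9) := by rw [hf]; ring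
    rw [this]
    exact mul_pos (by linarith) (by nlinarith)
  obtain ⟨q, hq, hfq⟩ := intermediate_value_Ioo hr0.le (f := f)
    (by fun_prop) ⟨hfr, hf0⟩
  refine ⟨q, ⟨hq.2.ne, hfq, (muSq_pos_iff hq.2).2 hq.1⟩, fun q' hq' => ?_⟩
  have hneg := hq'.neg hn
  have hlt := (muSq_pos_iff hneg).1 hq'.2.2
  have hfq' : f q' = 0 := hq'.2.1
  by_contra hne
  have hsum : 8 * ((n : ℝ) + 1) * (q' + q) + 2 * (3 * (n : ℝ) ^ 2 - 2 * n - 17) = 0 := by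
    refine ((mul_eq_zero (a := q' - q)).1 ?_).resolve_left (sub_ne_zero.2 hne)
    simp only [hf] at hfq hfq'
    linear_combination hfq' - hfq
  have hfac : f r = 8 * ((n : ℝ) + 1) * ((r - q) * (r - q')) := by
    simp only [hf] at hfq ⊢
    linear_combination hfq + (r - q) * hsum
  have h1 : 0 < (r - q) * (r - q') := mul_pos_of_neg_of_neg (by linarith [hq.1]) (by linarith)
  have h2 : 0 ≤ f r := by rw [hfac]; positivity
  linarith

/-! ### Reduction of the equation and spectral algebra of `B` -/

section

variable {n : ℕ} {B : Amb n →ₗ[ℝ] Amb n} {α β : ℝ}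

/-- The Euler-Lagrange equation at a point whose `B`-orbit spans at most a plane. -/
lemma equation_iff_eulerFactor (hB : B.IsSymmetric) (p q : ℝ) {x : Sph n}
    (hx : B (B x) = (α + β) • B x - (α * β) • (x : Amb n)) :
    ((1 + ‖quadGradField B x‖ ^ 2) • roughLaplacian (quadGradField B) x +
        (2 * p) • covDeriv (quadGradField B) x (gradHalfNormSq (quadGradField B) x) =
      (p * normSqCovDeriv (quadGradField B) x
        - p * q * ‖gradHalfNormSq (quadGradField B) x‖ ^ 2
        - q * (1 + ‖quadGradField B x‖ ^ 2) * sphLaplacian (halfNormSq (quadGradField B)) x) •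
          quadGradField B x) ↔
      eulerFactor p q n (LinearMap.trace ℝ _ B) (LinearMap.trace ℝ _ (B ∘ₗ B)) α β
        (inner ℝ (B x) (x : Amb n)) • quadGradField B x = 0 := by
  set σ := quadGradField B with hσ
  set m : ℝ := inner ℝ (B x) (x : Amb n) with hm
  have hσx : σ x = B x - m • (x : Amb n) := quadGradField_apply hB x
  have hm₂ : inner ℝ (B (B x)) (x : Amb n) = (α + β) * m - α * β := by
    rw [hx, inner_sub_left, inner_smul_left, inner_smul_left, inner_self_sph, ← hm]
    simp
  have hF : ‖σ x‖ ^ 2 = (m - β) * (α - m) := by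
    rw [hσ, norm_sq_quadGradField hB, hm₂, ← hm]
    ring
  have hX : gradHalfNormSq σ x = (α + β - 2 * m) • σ x := by
    rw [hσ, gradHalfNormSq_quadGradField hB, hm₂, ← hσ, hσx, hx, ← hm]
    module
  have hcov : covDeriv σ x (σ x) = (α + β - 2 * m) • σ x := by
    have ht : inner ℝ (x : Amb n) (σ x) = 0 :=
      mem_tangentSpace.1 ((isSmoothVectorField_quadGradField hB).tangent x)
    rw [hσ, covDeriv_quadGradField_of_tangent hB ht, ← hσ, ← hm, hσx]
    have hi : inner ℝ (B x) (B x) = (α + β) * m - α * β := by rw [← hB, hm₂]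
    rw [inner_sub_right, inner_smul_right, hi, ← hm, map_sub, map_smul, hx]
    module
  rw [hX, map_smul, hcov, norm_smul, mul_pow, hF, hσ, roughLaplacian_quadGradField hB,
    normSqCovDeriv_quadGradField hB, sphLaplacian_halfNormSq_quadGradField hB, hm₂, ← hσ, ← hm,
    ← sub_eq_zero, Real.norm_eq_abs, sq_abs]
  refine Eq.congr_left ?_
  rw [eulerFactor]
  module

lemma exists_unit_eigenvector (h : Module.End.HasEigenvalue B α) :
    ∃ e : Amb n, inner ℝ e e = (1 : ℝ) ∧ B e = α • e := by
  obtain ⟨v, hv⟩ := h.exists_hasEigenvector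
  have hv0 : ‖v‖ ≠ 0 := norm_ne_zero_iff.2 hv.2
  refine ⟨‖v‖⁻¹ • v, ?_, ?_⟩
  · rw [real_inner_self_eq_norm_sq, norm_smul, norm_inv, norm_norm, inv_mul_cancel₀ hv0, one_pow]
  · rw [map_smul, hv.apply_eq_smul, smul_comm]

lemma inner_eigenvectors_eq_zero (hB : B.IsSymmetric) {u v : Amb n} (hαβ : α ≠ β)
    (hu : B u = α • u) (hv : B v = β • v) : inner ℝ u v = (0 : ℝ) := by
  have h := hB u v
  rw [hu, hv, inner_smul_left, inner_smul_right, conj_trivial] at h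
  exact (mul_eq_zero.1 (show (α - β) * inner ℝ u v = 0 by linear_combination h)).resolve_left
    (sub_ne_zero.2 hαβ)

/-- A nonzero quadratic gradient field comes from a map with two distinct eigenvalues. -/
lemma exists_two_eigenvalues (hB : B.IsSymmetric) (h : quadGradField B ≠ 0) :
    ∃ α β : ℝ, α ≠ β ∧ Module.End.HasEigenvalue B α ∧ Module.End.HasEigenvalue B β := by
  have hn : Module.finrank ℝ (Amb n) = n + 1 := finrankAmb n |>.out
  by_contra! hne
  refine h ?_
  have hev : ∀ i, hB.eigenvalues hn i = hB.eigenvalues hn 0 := by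
    intro i
    by_contra hi
    exact hne _ _ hi (hB.hasEigenvalue_eigenvalues hn i) (hB.hasEigenvalue_eigenvalues hn 0)
  have hscal : B = hB.eigenvalues hn 0 • LinearMap.id := by
    refine (hB.eigenvectorBasis hn).toBasis.ext fun i => ?_
    have h1 : B (hB.eigenvectorBasis hn i) =
        hB.eigenvalues hn i • hB.eigenvectorBasis hn i := hB.apply_eigenvectorBasis hn i
    rw [OrthonormalBasis.coe_toBasis, h1, hev]
    rfl
  funext x
  have hx : B x = hB.eigenvalues hn 0 • (x : Amb n) := by
    conv_lhs => rw [hscal]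
    rfl
  rw [quadGradField_apply hB, hx, inner_smul_left, inner_self_sph]
  simp

lemma map_map_eq_of_two_eigenvalues (hB : B.IsSymmetric)
    (h : ∀ c : ℝ, Module.End.HasEigenvalue B c → c = α ∨ c = β) (v : Amb n) :
    B (B v) = (α + β) • B v - (α * β) • v := by
  have hn : Module.finrank ℝ (Amb n) = n + 1 := finrankAmb n |>.out
  have key : B ∘ₗ B = (α + β) • B - (α * β) • LinearMap.id := by
    refine (hB.eigenvectorBasis hn).toBasis.ext fun i => ?_
    have h1 : B (hB.eigenvectorBasis hn i) =
        hB.eigenvalues hn i • hB.eigenvectorBasis hn i := hB.apply_eigenvectorBasis hn i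
    have h2 : hB.eigenvalues hn i = α ∨ hB.eigenvalues hn i = β :=
      h _ (hB.hasEigenvalue_eigenvalues hn i)
    simp only [OrthonormalBasis.coe_toBasis, LinearMap.comp_apply, LinearMap.sub_apply,
      LinearMap.smul_apply, LinearMap.id_apply, h1, map_smul]
    rcases h2 with h2 | h2 <;>
    · rw [h2]
      module
  exact DFunLike.congr_fun key v

lemma trace_comp_self (h : ∀ v, B (B v) = (α + β) • B v - (α * β) • v) :
    LinearMap.trace ℝ _ (B ∘ₗ B) =
      (α + β) * LinearMap.trace ℝ _ B - α * β * ((n : ℝ) + 1) := by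
  have key : B ∘ₗ B = (α + β) • B - (α * β) • LinearMap.id := LinearMap.ext h
  rw [key, map_sub, map_smul, map_smul, LinearMap.trace_id, (finrankAmb n).out]
  simp

/-- `(α-β)⁻¹ (B - β)` is a projection onto the `α`-eigenspace, and the trace of a projection is its
rank. -/
lemma finrank_eigenspace_mul (hαβ : α ≠ β)
    (h : ∀ v, B (B v) = (α + β) • B v - (α * β) • v) :
    (Module.finrank ℝ (Module.End.eigenspace B α) : ℝ) * (α - β) =
      LinearMap.trace ℝ _ B - ((n : ℝ) + 1) * β := by
  have hd : α - β ≠ 0 := sub_ne_zero.2 hαβ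
  have hproj : LinearMap.IsProj (Module.End.eigenspace B α)
      ((α - β)⁻¹ • (B - β • LinearMap.id)) := by
    refine ⟨fun v => ?_, fun v hv => ?_⟩
    · rw [Module.End.mem_eigenspace_iff]
      simp only [LinearMap.smul_apply, LinearMap.sub_apply, LinearMap.id_apply, map_smul, map_sub,
        h v]
      module
    · rw [Module.End.mem_eigenspace_iff] at hv
      simp only [LinearMap.smul_apply, LinearMap.sub_apply, LinearMap.id_apply, hv]
      rw [← sub_smul, inv_smul_smul₀ hd]
  rw [← hproj.trace, map_smul, map_sub, map_smul, LinearMap.trace_id, (finrankAmb n).out,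
    smul_eq_mul, smul_eq_mul]
  push_cast
  field_simp

/-- On the great circle through two eigenvectors, `Bx · x` takes every value between the
eigenvalues. -/
lemma exists_sphere_point (hB : B.IsSymmetric) (hαβ : α ≠ β)
    (hα : Module.End.HasEigenvalue B α) (hβ : Module.End.HasEigenvalue B β)
    {s : ℝ} (h0 : 0 < s) (h1 : s < 1) :
    ∃ x : Sph n, B (B x) = (α + β) • B x - (α * β) • (x : Amb n) ∧
      inner ℝ (B x) (x : Amb n) = β + s * (α - β) ∧ quadGradField B x ≠ 0 := by
  obtain ⟨e, he, hBe⟩ := exists_unit_eigenvector hα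
  obtain ⟨f, hf, hBf⟩ := exists_unit_eigenvector hβ
  have hef := inner_eigenvectors_eq_zero hB hαβ hBe hBf
  have hfe := inner_eigenvectors_eq_zero hB hαβ.symm hBf hBe
  have hs : √s * √s = s := Real.mul_self_sqrt h0.le
  have ht : √(1 - s) * √(1 - s) = 1 - s := Real.mul_self_sqrt (by linarith)
  have hx : √s • e + √(1 - s) • f ∈ Metric.sphere (0 : Amb n) 1 := by
    rw [mem_sphere_zero_iff_norm, ← sq_eq_sq₀ (norm_nonneg _) zero_le_one,
      ← real_inner_self_eq_norm_sq]
    simp only [inner_add_left, inner_add_right, inner_smul_left, inner_smul_right, he, hf, hef,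
      hfe, conj_trivial]
    linear_combination hs + ht
  have hquad : B (B (√s • e + √(1 - s) • f)) = (α + β) • B (√s • e + √(1 - s) • f) -
      (α * β) • (√s • e + √(1 - s) • f) := by
    simp only [map_add, map_smul, hBe, hBf]
    module
  have hm : inner ℝ (B (√s • e + √(1 - s) • f)) (√s • e + √(1 - s) • f) =
      β + s * (α - β) := by
    simp only [map_add, map_smul, hBe, hBf, inner_add_left, inner_add_right, inner_smul_left,
      inner_smul_right, he, hf, hef, hfe, conj_trivial]
    linear_combination α * hs + β * ht
  refine ⟨⟨_, hx⟩, hquad, hm, fun hzero => ?_⟩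
  have hF := norm_sq_quadGradField hB ⟨_, hx⟩
  simp only [hzero, hquad, inner_sub_left, inner_smul_left, hm, conj_trivial] at hF
  rw [inner_self_sph ⟨_, hx⟩] at hF
  -- The left side is `|σ|²` at this point.
  have hF' : s * (1 - s) * (α - β) ^ 2 = 0 := by
    simp only [norm_zero] at hF
    linear_combination -hF
  exact mul_ne_zero (mul_ne_zero h0.ne' (by linarith)) (pow_ne_zero 2 (sub_ne_zero.2 hαβ)) hF'

/-! ### Necessity -/

lemma IsPQHarmonic.eulerFactor_eq_zero {p q : ℝ} (hB : B.IsSymmetric)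
    (h : IsPQHarmonic p q (quadGradField B)) (hαβ : α ≠ β)
    (hα : Module.End.HasEigenvalue B α) (hβ : Module.End.HasEigenvalue B β)
    (s : ℝ) (h0 : 0 < s) (h1 : s < 1) :
    eulerFactor p q n (LinearMap.trace ℝ _ B) (LinearMap.trace ℝ _ (B ∘ₗ B)) α β
      (β + s * (α - β)) = 0 := by
  obtain ⟨x, hx, hm, hne⟩ := exists_sphere_point hB hαβ hα hβ h0 h1
  have := (equation_iff_eulerFactor hB p q hx).1 (h.equation x)
  rw [hm] at this
  exact (smul_eq_zero.1 this).resolve_right hne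

/-- As `∇*∇σ` is a multiple of `σ` and `p ≠ 0`, so is `∇_X σ = BX - (Bx · X) x - m X`. Since `X` is
`B²x - 2m Bx` plus a multiple of `x`, up to a further multiple of `Bx`, the coefficient of `B²x` is
`2m` from `BX` plus `m` from `m X`. Only this coefficient matters later. -/
lemma IsPQHarmonic.exists_cubic {p q : ℝ} (hB : B.IsSymmetric) (hp : p ≠ 0)
    (h : IsPQHarmonic p q (quadGradField B)) (x : Sph n) :
    ∃ a b : ℝ, B (B (B x)) =
      (3 * inner ℝ (B x) (x : Amb n)) • B (B x) + a • B x + b • (x : Amb n) := by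
  have heq := h.equation x
  set X := gradHalfNormSq (quadGradField B) x with hX
  have hX' := gradHalfNormSq_quadGradField hB x
  rw [← hX] at hX'
  have ht : inner ℝ (x : Amb n) X = 0 := by
    rw [hX']
    simp only [inner_sub_right, inner_smul_right, inner_self_sph, real_inner_comm (B (B x)),
      real_inner_comm (B x)]
    simp [real_inner_comm]
  rw [roughLaplacian_quadGradField hB, covDeriv_quadGradField_of_tangent hB ht, smul_smul,
    ← eq_sub_iff_add_eq', ← sub_smul, quadGradField_apply hB] at heq
  generalize inner ℝ (B x) X = c at heq
  generalize p * normSqCovDeriv (quadGradField B) x - _ - _ - _ = r at heq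
  have heq' : B X = (c + -((2 * p)⁻¹ * r * inner ℝ (B x) (x : Amb n))) • (x : Amb n) +
      ((2 * p)⁻¹ * r) • B x + inner ℝ (B x) (x : Amb n) • X := by
    have h1 := congrArg ((2 * p)⁻¹ • ·) heq
    simp only [inv_smul_smul₀ (mul_ne_zero two_ne_zero hp)] at h1
    rw [sub_sub, sub_eq_iff_eq_add] at h1
    rw [h1]
    module
  rw [hX'] at heq'
  simp only [map_sub, map_smul] at heq'
  generalize inner ℝ (B x) (x : Amb n) = m at heq' ⊢
  generalize inner ℝ (B (B x)) (x : Amb n) = m₂ at heq'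
  refine ⟨m₂ - 4 * m ^ 2 + (2 * p)⁻¹ * r, c - (2 * p)⁻¹ * r * m - m * m₂ + 2 * m ^ 3, ?_⟩
  rw [sub_sub, sub_eq_iff_eq_add] at heq'
  rw [heq']
  module

/-- Vieta's formula for the sum of the roots, by successive divided differences. -/
lemma sum_eq_of_cubic {a b m x y z : ℝ} (hxy : x ≠ y) (hxz : x ≠ z) (hyz : y ≠ z)
    (hx : x ^ 3 = 3 * m * x ^ 2 + a * x + b) (hy : y ^ 3 = 3 * m * y ^ 2 + a * y + b)
    (hz : z ^ 3 = 3 * m * z ^ 2 + a * z + b) : x + y + z = 3 * m := by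
  have h1 : x ^ 2 + x * y + y ^ 2 - 3 * m * (x + y) - a = 0 :=
    (mul_eq_zero.1 (show (x - y) * _ = 0 by linear_combination hx - hy)).resolve_left
      (sub_ne_zero.2 hxy)
  have h2 : x ^ 2 + x * z + z ^ 2 - 3 * m * (x + z) - a = 0 :=
    (mul_eq_zero.1 (show (x - z) * _ = 0 by linear_combination hx - hz)).resolve_left
      (sub_ne_zero.2 hxz)
  have h3 : x + y + z - 3 * m = 0 :=
    (mul_eq_zero.1 (show (y - z) * _ = 0 by linear_combination h1 - h2)).resolve_left
      (sub_ne_zero.2 hyz)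
  linarith

/-- At a unit combination of three eigenvectors with nonzero weights, the cubic relation makes all
three eigenvalues roots of one cubic, so `α + β + γ = 3m`; but `m` varies with the weights. -/
lemma IsPQHarmonic.eigenvalue_eq_or_eq {p q γ : ℝ} (hB : B.IsSymmetric) (hp : p ≠ 0)
    (h : IsPQHarmonic p q (quadGradField B)) (hαβ : α ≠ β)
    (hα : Module.End.HasEigenvalue B α) (hβ : Module.End.HasEigenvalue B β)
    (hγ : Module.End.HasEigenvalue B γ) : γ = α ∨ γ = β := by
  by_contra! hne
  obtain ⟨hγα, hγβ⟩ := hne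
  obtain ⟨e, he, hBe⟩ := exists_unit_eigenvector hα
  obtain ⟨f, hf, hBf⟩ := exists_unit_eigenvector hβ
  obtain ⟨g, hg, hBg⟩ := exists_unit_eigenvector hγ
  have hef := inner_eigenvectors_eq_zero hB hαβ hBe hBf
  have hfe := inner_eigenvectors_eq_zero hB hαβ.symm hBf hBe
  have heg := inner_eigenvectors_eq_zero hB hγα.symm hBe hBg
  have hge := inner_eigenvectors_eq_zero hB hγα hBg hBe
  have hfg := inner_eigenvectors_eq_zero hB hγβ.symm hBf hBg
  have hgf := inner_eigenvectors_eq_zero hB hγβ hBg hBf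
  have key : ∀ a b c : ℝ, a ^ 2 + b ^ 2 + c ^ 2 = 1 → a ≠ 0 → b ≠ 0 → c ≠ 0 →
      α + β + γ = 3 * (a ^ 2 * α + b ^ 2 * β + c ^ 2 * γ) := by
    intro a b c habc ha hb hc
    have hx : a • e + b • f + c • g ∈ Metric.sphere (0 : Amb n) 1 := by
      rw [mem_sphere_zero_iff_norm, ← sq_eq_sq₀ (norm_nonneg _) zero_le_one,
        ← real_inner_self_eq_norm_sq]
      simp only [inner_add_left, inner_add_right, inner_smul_left, inner_smul_right, he, hf, hg,
        hef, hfe, heg, hge, hfg, hgf, conj_trivial]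
      linear_combination habc
    have hm : inner ℝ (B (a • e + b • f + c • g)) (a • e + b • f + c • g) =
        a ^ 2 * α + b ^ 2 * β + c ^ 2 * γ := by
      simp only [map_add, map_smul, hBe, hBf, hBg, inner_add_left, inner_add_right,
        inner_smul_left, inner_smul_right, he, hf, hg, hef, hfe, heg, hge, hfg, hgf, conj_trivial]
      ring
    obtain ⟨r, k, hrk⟩ := h.exists_cubic hB hp ⟨_, hx⟩
    simp only [hm] at hrk
    simp only [map_add, map_smul, hBe, hBf, hBg] at hrk
    generalize a ^ 2 * α + b ^ 2 * β + c ^ 2 * γ = m at *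
    have h1 := congrArg (inner ℝ e) hrk
    have h2 := congrArg (inner ℝ f) hrk
    have h3 := congrArg (inner ℝ g) hrk
    simp only [inner_add_right, inner_smul_right, he, hf, hg, hef, hfe, heg, hge, hfg, hgf]
      at h1 h2 h3
    exact sum_eq_of_cubic (a := r) (b := k) hαβ hγα.symm hγβ.symm
      (mul_left_cancel₀ ha (by linear_combination h1))
      (mul_left_cancel₀ hb (by linear_combination h2))
      (mul_left_cancel₀ hc (by linear_combination h3))
  -- Exchanging the first two weights of a rational unit vector changes `3m` by `α - β`.
  have k1 := key (2 / 3) (1 / 3) (2 / 3) (by norm_num) (by norm_num) (by norm_num) (by norm_num)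
  have k2 := key (1 / 3) (2 / 3) (2 / 3) (by norm_num) (by norm_num) (by norm_num) (by norm_num)
  exact hαβ (by linarith)

lemma HasTwoEigenvalues.quadGradField_ne_zero {μ : ℝ} (hB : B.IsSymmetric)
    (h : HasTwoEigenvalues B μ) : quadGradField B ≠ 0 := by
  obtain ⟨α, β, hαβ, hev, -⟩ := h
  obtain ⟨x, -, -, hx⟩ := exists_sphere_point hB hαβ ((hev α).2 (.inl rfl)) ((hev β).2 (.inr rfl))
    (s := 1 / 2) (by norm_num) (by norm_num)
  exact fun h0 => hx (congrFun h0 x)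

lemma IsPQHarmonic.classification {p q : ℝ} (hB : B.IsSymmetric) (hne : quadGradField B ≠ 0)
    (h : IsPQHarmonic p q (quadGradField B)) :
    Odd n ∧ 5 ≤ n ∧ p = ((n : ℝ) + 3) / 2 ∧ AdmissibleQ n q ∧
      HasTwoEigenvalues B (Real.sqrt (muSq n q)) := by
  obtain ⟨α, β, hαβ, hα, hβ⟩ := exists_two_eigenvalues hB hne
  have hE := h.eulerFactor_eq_zero hB hαβ hα hβ
  have hp : p ≠ 0 := ne_zero_of_eulerFactor_eq_zero (by positivity) hαβ hE
  have hev : ∀ c : ℝ, Module.End.HasEigenvalue B c ↔ c = α ∨ c = β := by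
    refine fun c => ⟨h.eigenvalue_eq_or_eq hB hp hαβ hα hβ, ?_⟩
    rintro (rfl | rfl) <;> assumption
  have hquad := map_map_eq_of_two_eigenvalues hB fun c => (hev c).1
  rw [trace_comp_self hquad] at hE
  have hT := trace_eq_of_eulerFactor_eq_zero hp hαβ hE
  have hfα := finrank_eigenspace_mul hαβ hquad
  have hfβ := finrank_eigenspace_mul hαβ.symm (B := B)
    (by simpa only [add_comm, mul_comm] using hquad)
  rw [hT] at hE hfα hfβ
  have hd : α - β ≠ 0 := sub_ne_zero.2 hαβ
  have ha : 2 * Module.finrank ℝ (Module.End.eigenspace B α) = n + 1 := by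
    have : (2 * Module.finrank ℝ (Module.End.eigenspace B α) : ℝ) = n + 1 :=
      mul_right_cancel₀ hd (by linear_combination 2 * hfα)
    exact_mod_cast this
  have hb : 2 * Module.finrank ℝ (Module.End.eigenspace B β) = n + 1 := by
    have : (2 * Module.finrank ℝ (Module.End.eigenspace B β) : ℝ) = n + 1 :=
      mul_right_cancel₀ hd (by linear_combination (-2) * hfβ)
    exact_mod_cast this
  have hodd : Odd n := by
    rw [← Nat.not_even_iff_odd, ← Nat.even_add_one.not_left, not_not, ← ha]
    exact even_two_mul _
  obtain ⟨hp', hq, hmu⟩ := (eulerCoeffsVanish_of_eulerFactor_eq_zero hαβ hE).admissible hodd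
    (by positivity)
  refine ⟨hodd, five_le_of_admissibleQ hodd hq, hp', hq, α, β, hαβ, hev, ha, hb, ?_⟩
  rw [hmu, Real.sqrt_sq_eq_abs]

/-! ### Sufficiency and existence -/

lemma isPQHarmonic_of_hasTwoEigenvalues {q : ℝ} (hB : B.IsSymmetric) (hq : AdmissibleQ n q)
    (h : HasTwoEigenvalues B (Real.sqrt (muSq n q))) :
    IsPQHarmonic (((n : ℝ) + 3) / 2) q (quadGradField B) := by
  obtain ⟨α, β, hαβ, hev, ha, -, hμ⟩ := h
  have hquad := map_map_eq_of_two_eigenvalues hB fun c => (hev c).1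
  have hM : (α - β) ^ 2 = muSq n q := by rw [← sq_abs, hμ, Real.sq_sqrt hq.2.2.le]
  have hf := finrank_eigenspace_mul hαβ hquad
  have ha' : (2 * Module.finrank ℝ (Module.End.eigenspace B α) : ℝ) = n + 1 := by exact_mod_cast ha
  have hT : LinearMap.trace ℝ _ B = ((n : ℝ) + 1) * (α + β) / 2 := by
    linear_combination -hf + (α - β) / 2 * ha'
  have hc := eulerCoeffsVanish_of_admissibleQ hq
  rw [← hM] at hc
  refine ⟨isSmoothVectorField_quadGradField hB, fun x => ?_⟩
  rw [equation_iff_eulerFactor hB _ _ (hquad x), trace_comp_self hquad, hT, eulerFactor_balanced,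
    hc.zero, hc.one, hc.two]
  simp

lemma exists_submodule_finrank {E : Type*} [AddCommGroup E] [Module ℝ E] [FiniteDimensional ℝ E]
    {k : ℕ} (hk : k ≤ Module.finrank ℝ E) : ∃ K : Submodule ℝ E, Module.finrank ℝ K = k := by
  obtain ⟨v, hv⟩ := exists_linearIndependent_of_le_finrank hk
  exact ⟨Submodule.span ℝ (Set.range v), by simpa using finrank_span_eq_card hv⟩

/-- The witness is `μ` times the orthogonal projection onto a subspace of half the ambient
dimension, with eigenvalues `μ` and `0`. -/
lemma exists_hasTwoEigenvalues (hn : Odd n) {μ : ℝ} (hμ : 0 < μ) :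
    ∃ B : Amb n →ₗ[ℝ] Amb n, B.IsSymmetric ∧ HasTwoEigenvalues B μ := by
  obtain ⟨k, rfl⟩ := hn
  have hdim := (finrankAmb (2 * k + 1)).out
  obtain ⟨K, hK⟩ := exists_submodule_finrank (E := Amb (2 * k + 1)) (k := k + 1) (by omega)
  have hK' : Module.finrank ℝ Kᗮ = k + 1 := by
    have := K.finrank_add_finrank_orthogonal
    omega
  set B : Amb (2 * k + 1) →ₗ[ℝ] Amb (2 * k + 1) := μ • K.starProjection.toLinearMap with hBdef
  have hB : ∀ v, B v = μ • K.starProjection v := fun v => rfl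
  have hKμ : Module.End.eigenspace B μ = K := by
    ext v
    rw [Module.End.mem_eigenspace_iff, hB, smul_right_inj hμ.ne', K.starProjection_eq_self_iff]
  have hK0 : Module.End.eigenspace B 0 = Kᗮ := by
    ext v
    rw [Module.End.mem_eigenspace_iff, hB, zero_smul, smul_eq_zero_iff_right hμ.ne',
      K.starProjection_apply_eq_zero_iff]
  have hbot : ∀ L : Submodule ℝ (Amb (2 * k + 1)), Module.finrank ℝ L = k + 1 → L ≠ ⊥ := by
    rintro L hL rfl
    simp at hL
  refine ⟨B, fun u v => ?_, μ, 0, hμ.ne', fun c => ⟨fun hc => ?_, ?_⟩, ?_, ?_, ?_⟩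
  · rw [hB, hB, inner_smul_left, inner_smul_right, K.inner_starProjection_left_eq_right]
    rfl
  · obtain ⟨v, hv⟩ := hc.exists_hasEigenvector
    have h1 : μ • K.starProjection v = c • v := hv.apply_eq_smul
    -- Idempotence gives `(μ - c)` times the projection of `v` equal to zero.
    have h2 := congrArg K.starProjection h1
    rw [map_smul, map_smul, K.starProjection_eq_self_iff.2 (K.starProjection_apply_mem v),
      ← sub_eq_zero, ← sub_smul] at h2
    rcases smul_eq_zero.1 h2 with h3 | h3
    · exact .inl (sub_eq_zero.1 h3).symm
    · rw [h3, smul_zero] at h1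
      exact .inr ((smul_eq_zero.1 h1.symm).resolve_right hv.2)
  · rintro (rfl | rfl)
    · exact fun h0 => hbot K hK (hKμ.symm.trans h0)
    · exact fun h0 => hbot _ hK' (hK0.symm.trans h0)
  · rw [hKμ, hK]
    ring
  · rw [hK0, hK']
    ring
  · rw [sub_zero, abs_of_pos hμ]

end

end SphereField

end

theorem mainTheorem1 (n : ℕ) :
    (∀ p q : ℝ,
      (∀ B : SphereField.Amb n →ₗ[ℝ] SphereField.Amb n, B.IsSymmetric →
        SphereField.quadGradField B ≠ 0 →
        (SphereField.IsPQHarmonic p q (SphereField.quadGradField B) ↔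
          Odd n ∧ 5 ≤ n ∧ p = ((n : ℝ) + 3) / 2 ∧ SphereField.AdmissibleQ n q ∧
            SphereField.HasTwoEigenvalues B (Real.sqrt (SphereField.muSq n q)))) ∧
      ((∃ B : SphereField.Amb n →ₗ[ℝ] SphereField.Amb n, B.IsSymmetric ∧
          SphereField.quadGradField B ≠ 0 ∧
          SphereField.IsPQHarmonic p q (SphereField.quadGradField B)) ↔
        Odd n ∧ 5 ≤ n ∧ p = ((n : ℝ) + 3) / 2 ∧ SphereField.AdmissibleQ n q)) ∧
    (Odd n → 5 ≤ n →
      (∃! q : ℝ, SphereField.AdmissibleQ n q) ∧ ∀ q : ℝ, SphereField.AdmissibleQ n q → q < 0) := by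
  refine ⟨fun p q => ⟨fun B hB hne => ⟨fun h => h.classification hB hne, ?_⟩, ?_, ?_⟩,
    fun _ hn => ⟨SphereField.existsUnique_admissibleQ hn, fun q hq => hq.neg hn⟩⟩
  · rintro ⟨-, -, rfl, hq, h2⟩
    exact SphereField.isPQHarmonic_of_hasTwoEigenvalues hB hq h2
  · rintro ⟨B, hB, hne, h⟩
    obtain ⟨h1, h2, h3, h4, -⟩ := h.classification hB hne
    exact ⟨h1, h2, h3, h4⟩
  · rintro ⟨hn, -, rfl, hq⟩
    obtain ⟨B, hB, h2⟩ :=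
      SphereField.exists_hasTwoEigenvalues hn (Real.sqrt_pos.2 hq.2.2)
    exact ⟨B, hB, h2.quadGradField_ne_zero hB,
      SphereField.isPQHarmonic_of_hasTwoEigenvalues hB hq h2⟩
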